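/- Let $h\ge 2$ and $k\ge 1$ be integers and $[k]=\{1,\dots,k\}$. Let $T^h_2$ be the full binary tree with $h$ levels, with nodes $1,\dots,2^h-1$ in heap order (the root is $1$; the children of an internal node $i$ are $2i$ and $2i+1$). An input $I$ of the Tree Evaluation Problem $TEP^h_2(k)$ consists of a value $v_i\in[k]$ for each leaf $i$ and a function table $f_i:[k]\times[k]\to[k]$ for each internal node $i$; its input variables are the $v_i$ ($i$ a leaf) and the entries $f_i(x,y)$ ($i$ internal, $x,y\in[k]$). Put $v^I_i=v_i$ at the leaves and $v^I_i=f_i(v^I_{2i},v^I_{2i+1})$ at the internal nodes. The problem is to compute $v^I_1$. A (possibly non-deterministic) $k$-way branching program is a finite directed graph (parallel edges allowed) whose vertices are called states. It has exactly $k$ sinks, the output states, labelled with the distinct elements of $[k]$; every other state is labelled with an input variable, which it queries; every edge is labelled with an element of $[k]$; and there is exactly one source, the start state. A computation path of $I$ is a path from the start state in which each edge, leaving a state that queries a variable $q$, is labelled with the value of $q$ in $I$. A path is complete if it goes from the start state to an output state. The program solves $TEP^h_2(k)$ if every input $I$ has a complete computation path and every complete computation path of $I$ ends at the output state labelled $v^I_1$.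 It is (syntactic) read-once if every complete path, whether or not it is a computation path of some input, queries every input variable at most once. For a state $\gamma$ and a node $i$, let $R_\gamma(i)$ be the set of the values $v^I_i$ over all inputs $I$ that have a computation path reaching $\gamma$, and $A_\gamma(i)$ the set of the values $v^I_i$ over all inputs $I$ that have a complete computation path through $\gamma$. The program is node-independent if for every state $\gamma$ and every input $I$: (1) $I$ has a computation path reaching $\gamma$ if and only if $v^I_i\in R_\gamma(i)$ for all nodes $i$; and (2) $I$ has a complete computation path through $\gamma$ if and only if $v^I_i\in A_\gamma(i)$ for all nodes $i$. Theorem. Every (possibly non-deterministic) node-independent, syntactic read-once branching program solving $TEP^h_2(k)$ has at least $k^{h/2+1}$ states. -/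

import Mathlib

/-! ## The tree and the Tree Evaluation Problem -/

/-- Nodes of the full binary tree with `h` levels, numbered in heap order: the numbers
`1, …, 2 ^ h - 1`; the root is `1` and the children of an internal node `i` are `2 * i`
and `2 * i + 1`. -/
abbrev TreeNode (h : ℕ) : Type := {i : ℕ // i ∈ Finset.Ico 1 (2 ^ h)}

namespace TreeNode

variable {h : ℕ}

/-- The internal nodes are `1, …, 2 ^ (h - 1) - 1`. -/
def IsInternal (i : TreeNode h) : Prop := i.1 < 2 ^ (h - 1)

instance (i : TreeNode h) : Decidable i.IsInternal :=
  inferInstanceAs (Decidable (i.1 < 2 ^ (h - 1)))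

theorem IsInternal.two_mul_add_one_lt {i : TreeNode h} (hi : i.IsInternal) :
    2 * i.1 + 1 < 2 ^ h := by
  have h1 : 1 ≤ i.1 := (Finset.mem_Ico.mp i.2).1
  have h2 : i.1 < 2 ^ (h - 1) := hi
  cases h with
  | zero => simp at h2; omega
  | succ n =>
    have h3 : 2 ^ (n + 1) = 2 ^ n * 2 := pow_succ 2 n
    simp only [Nat.add_sub_cancel] at h2
    omega

/-- The root. -/
def root (hh : 0 < h) : TreeNode h :=
  ⟨1, Finset.mem_Ico.mpr ⟨le_rfl, Nat.one_lt_two_pow (Nat.pos_iff_ne_zero.mp hh)⟩⟩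

/-- The left child `2 * i`. -/
def left (i : TreeNode h) (hi : i.IsInternal) : TreeNode h :=
  ⟨2 * i.1, Finset.mem_Ico.mpr
    ⟨by have := (Finset.mem_Ico.mp i.2).1; omega, by have := hi.two_mul_add_one_lt; omega⟩⟩

/-- The right child `2 * i + 1`. -/
def right (i : TreeNode h) (hi : i.IsInternal) : TreeNode h :=
  ⟨2 * i.1 + 1, Finset.mem_Ico.mpr ⟨by omega, hi.two_mul_add_one_lt⟩⟩

end TreeNode

/-- The input variables of the Tree Evaluation Problem: one variable `v_i` for each leaf `i`, and
one variable `f_i(x, y)` for each internal node `i` and each pair `x, y`. The set of values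
with `k` elements is `Fin k`. -/
inductive TEPVar (h k : ℕ) : Type
  | leaf (i : TreeNode h) (hi : ¬ i.IsInternal)
  | func (i : TreeNode h) (hi : i.IsInternal) (x y : Fin k)

/-- An input assigns a value to every input variable. -/
abbrev TEPInput (h k : ℕ) : Type := TEPVar h k → Fin k

/-- The correct value `v_i` of node `i`: the given value at a leaf, and
`f_i(v_{2i}, v_{2i+1})` at an internal node. -/
def nodeValue {h k : ℕ} (I : TEPInput h k) (i : TreeNode h) : Fin k :=
  if hi : i.IsInternal then
    I (.func i hi (nodeValue I (i.left hi)) (nodeValue I (i.right hi)))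
  else
    I (.leaf i hi)
termination_by 2 ^ h - i.1
decreasing_by
  all_goals
    have h1 := (Finset.mem_Ico.mp i.2).1
    have h2 := hi.two_mul_add_one_lt
    simp only [TreeNode.left, TreeNode.right]
    omega

/-- The function to be computed: the value of the root. -/
def treeEval {h k : ℕ} (hh : 0 < h) (I : TEPInput h k) : Fin k :=
  nodeValue I (TreeNode.root hh)

/-! ## Branching programs -/

/-- A (possibly non-deterministic) `k`-way branching program with set of states `S` over the input
variables `V`. Every state is labelled either with a query or with an output; edges are labelled
with elements of `Fin k`, and `edge s a t` says that there is an edge from `s` to `t` with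
label `a`. -/
structure BranchingProgram (V : Type*) (k : ℕ) (S : Type*) where
  label : S → V ⊕ Fin k
  edge : S → Fin k → S → Prop
  start : S
  /-- Each value labels exactly one output state. -/
  existsUnique_output : ∀ c : Fin k, ∃! s, label s = Sum.inr c
  /-- The sinks are exactly the output states. -/
  sink_iff : ∀ s, (∀ a t, ¬ edge s a t) ↔ ∃ c, label s = Sum.inr c
  /-- The start state is the only source. -/
  source_iff : ∀ s, (∀ r a, ¬ edge r a s) ↔ s = start

namespace BranchingProgram

variable {V : Type*} {k : ℕ} {S : Type*}

/-- `B.IsPath s p t`: there is a directed path from `s` to `t` along which the queries made, with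
the labels of the edges taken, are in this order the list `p`. -/
inductive IsPath (B : BranchingProgram V k S) : S → List (V × Fin k) → S → Prop
  | nil (s : S) : IsPath B s [] s
  | cons {s t u : S} {q : V} {a : Fin k} {p : List (V × Fin k)}
      (hq : B.label s = Sum.inl q) (he : B.edge s a t) (hp : IsPath B t p u) :
      IsPath B s ((q, a) :: p) u

/-- The path with queries and edge labels `p` is consistent with the input `I`. -/
def Consistent (I : V → Fin k) (p : List (V × Fin k)) : Prop :=
  ∀ e ∈ p, I e.1 = e.2

/-- `I` reaches `γ`: some computation path of `I` ends at `γ`. -/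
def Reaches (B : BranchingProgram V k S) (I : V → Fin k) (γ : S) : Prop :=
  ∃ p, B.IsPath B.start p γ ∧ Consistent I p

/-- Some complete computation path of `I` goes through `γ`. -/
def CompletesThrough (B : BranchingProgram V k S) (I : V → Fin k) (γ : S) : Prop :=
  ∃ p₀ p₁ t c, B.IsPath B.start p₀ γ ∧ B.IsPath γ p₁ t ∧ B.label t = Sum.inr c ∧
    Consistent I p₀ ∧ Consistent I p₁

/-- `B` computes `f`: every input has a complete computation path, and all its complete
computation paths end at the output state labelled with the value of `f`. -/
def Computes (B : BranchingProgram V k S) (f : (V → Fin k) → Fin k) : Prop :=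
  ∀ I : V → Fin k,
    (∃ t c, B.Reaches I t ∧ B.label t = Sum.inr c) ∧
    (∀ t c, B.Reaches I t → B.label t = Sum.inr c → c = f I)

/-- Every complete path, whether or not some input can follow it, queries every input variable at
most once. -/
def SyntacticReadOnce (B : BranchingProgram V k S) : Prop :=
  ∀ p t c, B.IsPath B.start p t → B.label t = Sum.inr c → (p.map Prod.fst).Nodup

variable {h : ℕ}

/-- `R_γ(i)`: the values of node `i` under the inputs that reach `γ`. -/
def reachSet (B : BranchingProgram (TEPVar h k) k S) (γ : S) (i : TreeNode h) : Set (Fin k) :=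
  {a | ∃ I : TEPInput h k, B.Reaches I γ ∧ nodeValue I i = a}

/-- `A_γ(i)`: the values of node `i` under the inputs that have a complete computation path
through `γ`. -/
def acceptSet (B : BranchingProgram (TEPVar h k) k S) (γ : S) (i : TreeNode h) : Set (Fin k) :=
  {a | ∃ I : TEPInput h k, B.CompletesThrough I γ ∧ nodeValue I i = a}

/-- Node-independence: whether an input reaches a state (has a complete computation path through
it) is decided by a separate condition on the correct value of each node. -/
def NodeIndependent (B : BranchingProgram (TEPVar h k) k S) : Prop :=
  ∀ (γ : S) (I : TEPInput h k),
    (B.Reaches I γ ↔ ∀ i, nodeValue I i ∈ B.reachSet γ i) ∧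
    (B.CompletesThrough I γ ↔ ∀ i, nodeValue I i ∈ B.acceptSet γ i)

end BranchingProgram

/-! ## Inputs with prescribed node values -/

namespace TreeNode

variable {h : ℕ}

/-! The program plays black pebbling. Fix an input and call a node pebbled at a state when all
inputs reaching that state agree there. By `NodeIndependent.children_of_lost`, a node can become
pebbled in one step only if its children were pebbled just before. For `k ≥ 2` no node is pebbled at
the start, while the root is pebbled at the output, so some step of a complete path first blocks
every root-leaf path; `exists_card_of_blocked` then finds `h` pebbles.

Choose such a state for every vector of node values. The `h` pebbled values are fixed by the state,
so with `N` nodes a state serves at most `k ^ (N - h)` of the `k ^ N` vectors. This gives `k ^ h`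
states (`pow_le_card`), more than enough as `h / 2 + 1 ≤ h`. -/

theorem left_ne (i : TreeNode h) (hi : i.IsInternal) : i.left hi ≠ i := by
  intro e
  have h1 := (Finset.mem_Ico.mp i.2).1
  have h2 : 2 * i.1 = i.1 := congrArg Subtype.val e
  omega

theorem right_ne (i : TreeNode h) (hi : i.IsInternal) : i.right hi ≠ i := by
  intro e
  have h2 : 2 * i.1 + 1 = i.1 := congrArg Subtype.val e
  omega

end TreeNode

/-- The variable that determines the value of node `i` when the nodes have the values `w`. -/
def thriftyVar {h k : ℕ} (w : TreeNode h → Fin k) (i : TreeNode h) : TEPVar h k :=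
  if hi : i.IsInternal then .func i hi (w (i.left hi)) (w (i.right hi)) else .leaf i hi

section thriftyVar

variable {h k : ℕ}

theorem thriftyVar_inj {w w' : TreeNode h → Fin k} {i j : TreeNode h}
    (e : thriftyVar w i = thriftyVar w' j) : i = j := by
  unfold thriftyVar at e
  split_ifs at e <;> simp_all

theorem thriftyVar_of_internal (w : TreeNode h → Fin k) {i : TreeNode h} (hi : i.IsInternal) :
    thriftyVar w i = .func i hi (w (i.left hi)) (w (i.right hi)) :=
  dif_pos hi

theorem thriftyVar_update_self [DecidableEq (TreeNode h)] (w : TreeNode h → Fin k)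
    (i : TreeNode h) (c : Fin k) :
    thriftyVar (Function.update w i c) i = thriftyVar w i := by
  unfold thriftyVar
  split_ifs with hi
  · rw [Function.update_of_ne (i.left_ne hi), Function.update_of_ne (i.right_ne hi)]
  · rfl

theorem nodeValue_eq_thriftyVar (I : TEPInput h k) (i : TreeNode h) :
    nodeValue I i = I (thriftyVar (nodeValue I) i) := by
  rw [nodeValue, thriftyVar]
  split_ifs <;> rfl

theorem nodeValue_eq_of_thriftyVar {I : TEPInput h k} {w : TreeNode h → Fin k}
    (hI : ∀ i, I (thriftyVar w i) = w i) : nodeValue I = w := by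
  have key : ∀ n, ∀ i : TreeNode h, 2 ^ h - i.1 ≤ n → nodeValue I i = w i := by
    intro n
    induction n with
    | zero =>
      intro i hn
      have := (Finset.mem_Ico.mp i.2).2
      omega
    | succ n ih =>
      intro i hn
      have h1 := Finset.mem_Ico.mp i.2
      rw [← hI i, nodeValue_eq_thriftyVar]
      unfold thriftyVar
      split_ifs with hi
      · rw [ih (i.left hi) (by simp only [TreeNode.left]; omega),
          ih (i.right hi) (by simp only [TreeNode.right]; omega)]
      · rfl
  exact funext fun i => key _ i le_rfl

/-- The input whose tables are constant, with value `w i` at node `i`. -/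
def constInput (w : TreeNode h → Fin k) : TEPInput h k
  | .leaf i _ => w i
  | .func i _ _ _ => w i

theorem constInput_thriftyVar (w w' : TreeNode h → Fin k) (i : TreeNode h) :
    constInput w (thriftyVar w' i) = w i := by
  unfold thriftyVar
  split_ifs <;> rfl

theorem nodeValue_constInput (w : TreeNode h → Fin k) : nodeValue (constInput w) = w :=
  nodeValue_eq_of_thriftyVar fun i => constInput_thriftyVar w w i

/-- Evaluation reads only the thrifty variables of `w`; any other variable can take whatever value
an edge demands. -/
theorem nodeValue_update_constInput [DecidableEq (TEPVar h k)] {w : TreeNode h → Fin k}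
    {q : TEPVar h k} {a : Fin k} (hq : ∀ i, q = thriftyVar w i → w i = a) :
    nodeValue (Function.update (constInput w) q a) = w := by
  apply nodeValue_eq_of_thriftyVar
  intro i
  by_cases e : thriftyVar w i = q
  · rw [e, Function.update_self, hq i e.symm]
  · rw [Function.update_of_ne e, constInput_thriftyVar]

theorem nodeValue_update_constInput_thriftyVar [DecidableEq (TreeNode h)]
    [DecidableEq (TEPVar h k)] (w : TreeNode h → Fin k) (i : TreeNode h) (a : Fin k) :
    nodeValue (Function.update (constInput w) (thriftyVar w i) a) = Function.update w i a := by
  apply nodeValue_eq_of_thriftyVar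
  intro j
  by_cases e : j = i
  · subst e
    rw [thriftyVar_update_self, Function.update_self, Function.update_self]
  · rw [Function.update_of_ne (fun e' => e (thriftyVar_inj e')), constInput_thriftyVar,
      Function.update_of_ne e]

end thriftyVar

/-! ## Black pebblings of the full binary tree -/

/-- Every path from node `i` down to a leaf of the tree with `m` levels below and including `i`
meets `b`. -/
def Blocked (b : ℕ → Prop) : ℕ → ℕ → Prop
  | 0, _ => False
  | m + 1, i => b i ∨ (Blocked b m (2 * i) ∧ Blocked b m (2 * i + 1))

/-- `n` is one of the nodes of the tree with `m` levels and root `i`. -/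
def InSubtree (m i n : ℕ) : Prop := ∃ d < m, n / 2 ^ d = i

theorem InSubtree.of_child {m i n c : ℕ} (hc : c / 2 = i) (hn : InSubtree m c n) :
    InSubtree (m + 1) i n := by
  obtain ⟨d, hd, e⟩ := hn
  exact ⟨d + 1, by omega, by rw [pow_succ, ← Nat.div_div_eq_div_mul, e, hc]⟩

theorem not_inSubtree_left_right {m m' i n : ℕ} (hi : 1 ≤ i) (hl : InSubtree m (2 * i) n)
    (hr : InSubtree m' (2 * i + 1) n) : False := by
  obtain ⟨d, -, e⟩ := hl
  obtain ⟨d', -, e'⟩ := hr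
  -- A strictly higher ancestor of `n` is at most half a lower one, which two siblings rule out.
  have aux : ∀ {x y s t : ℕ}, n / 2 ^ s = x → n / 2 ^ t = y → s < t → y ≤ x / 2 := by
    intro x y s t hx hy hst
    obtain ⟨r, rfl⟩ := Nat.exists_eq_add_of_lt hst
    rw [← hy, ← hx, show s + r + 1 = (s + 1) + r by omega, pow_add, pow_succ,
      ← Nat.div_div_eq_div_mul, ← Nat.div_div_eq_div_mul]
    exact Nat.div_le_self _ _
  rcases lt_trichotomy d d' with hlt | rfl | hlt
  · have := aux e e' hlt; omega
  · omega
  · have := aux e' e hlt; omega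

theorem Blocked.exists_mem {b : ℕ → Prop} {m i : ℕ} (hb : Blocked b m i) :
    ∃ n, InSubtree m i n ∧ b n := by
  induction m generalizing i with
  | zero => exact hb.elim
  | succ m ih =>
    rcases hb with hb | ⟨hl, -⟩
    · exact ⟨i, ⟨0, by omega, by simp⟩, hb⟩
    · obtain ⟨n, hn, hbn⟩ := ih hl
      exact ⟨n, hn.of_child (by omega), hbn⟩

/-- When a legal step of a black pebbling blocks all the paths from a node to the leaves, at least
as many pebbles as there are levels are in use. -/
theorem exists_card_of_blocked {h : ℕ} {b b' : ℕ → Prop}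
    (hstep : ∀ i, 1 ≤ i → 2 * i + 1 < 2 ^ h → b' i → ¬ b i → b (2 * i) ∧ b (2 * i + 1))
    {m i : ℕ} (hi : 1 ≤ i) (hm : (i + 1) * 2 ^ m ≤ 2 * 2 ^ h)
    (hb : ¬ Blocked b m i) (hb' : Blocked b' m i) :
    ∃ F : Finset ℕ, F.card = m ∧ ∀ n ∈ F, InSubtree m i n ∧ b' n := by
  induction m generalizing i with
  | zero => exact hb'.elim
  | succ m ih =>
    have hbi : ¬ b i := fun hc => hb (Or.inl hc)
    by_cases hbi' : b' i
    -- A fresh pebble on `i` is possible only at a leaf, where it is the one pebble needed;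
    -- otherwise both children already blocked `i`.
    · cases m with
      | zero => exact ⟨{i}, by simp, by simpa using ⟨⟨0, by omega, by simp⟩, hbi'⟩⟩
      | succ m =>
        have h1 : 1 ≤ 2 ^ m := Nat.one_le_two_pow
        have h2 : (i + 1) * 2 ^ (m + 1 + 1) = 4 * ((i + 1) * 2 ^ m) := by ring
        have h3 : (i + 1) * 1 ≤ (i + 1) * 2 ^ m := Nat.mul_le_mul_left _ h1
        have h4 := hstep i hi (by omega) hbi' hbi
        exact (hb (Or.inr ⟨Or.inl h4.1, Or.inl h4.2⟩)).elim
    · obtain ⟨hl', hr'⟩ := hb'.resolve_left hbi'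
      have h2 : (i + 1) * 2 ^ (m + 1) = (2 * i + 1 + 1) * 2 ^ m := by ring
      have h3 : (2 * i + 1) * 2 ^ m ≤ (2 * i + 1 + 1) * 2 ^ m :=
        Nat.mul_le_mul_right _ (by omega)
      -- Induction supplies `m` pebbles below a newly blocked child `c`; its sibling `c'`, blocked
      -- too, supplies one more in a disjoint subtree.
      have insertOne : ∀ {c c' : ℕ}, c / 2 = i → c' / 2 = i →
          (∀ n, InSubtree m c n → InSubtree m c' n → False) →
          (∃ F : Finset ℕ, F.card = m ∧ ∀ n ∈ F, InSubtree m c n ∧ b' n) →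
          Blocked b' m c' →
          ∃ F : Finset ℕ, F.card = m + 1 ∧ ∀ n ∈ F, InSubtree (m + 1) i n ∧ b' n := by
        rintro c c' hc hc' hdisj ⟨F, hF, hFb⟩ hblk
        obtain ⟨n, hn, hbn⟩ := hblk.exists_mem
        refine ⟨insert n F, ?_, ?_⟩
        · rw [Finset.card_insert_of_notMem fun hnF => hdisj n (hFb n hnF).1 hn, hF]
        · intro x hx
          rcases Finset.mem_insert.mp hx with rfl | hx
          · exact ⟨hn.of_child hc', hbn⟩
          · exact ⟨(hFb x hx).1.of_child hc, (hFb x hx).2⟩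
      by_cases hl : Blocked b m (2 * i)
      · have hr : ¬ Blocked b m (2 * i + 1) := fun hr => hb (Or.inr ⟨hl, hr⟩)
        exact insertOne (by omega) (by omega)
          (fun n h h' => not_inSubtree_left_right hi h' h)
          (ih (by omega) (by omega) hr hr') hl'
      · exact insertOne (by omega) (by omega)
          (fun n h h' => not_inSubtree_left_right hi h h')
          (ih (by omega) (by omega) hl hl') hr'

/-! ## Reachability in node-independent read-once programs -/

namespace BranchingProgram

section paths

variable {V : Type*} {k : ℕ} {S : Type*} {B : BranchingProgram V k S}

theorem IsPath.append {s t u : S} {p p' : List (V × Fin k)} (hp : B.IsPath s p t)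
    (hp' : B.IsPath t p' u) : B.IsPath s (p ++ p') u := by
  induction hp with
  | nil => exact hp'
  | cons hq he _ ih => exact .cons hq he (ih hp')

theorem Reaches.step {I : V → Fin k} {γ δ : S} {q : V} {a : Fin k} (hr : B.Reaches I γ)
    (hq : B.label γ = Sum.inl q) (he : B.edge γ a δ) (hI : I q = a) : B.Reaches I δ := by
  obtain ⟨p, hp, hc⟩ := hr
  refine ⟨p ++ [(q, a)], hp.append (.cons hq he (.nil δ)), fun e he' => ?_⟩
  rcases List.mem_append.mp he' with h | h
  · exact hc e h
  · rw [List.mem_singleton.mp h]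
    exact hI

theorem reaches_start (I : V → Fin k) : B.Reaches I B.start :=
  ⟨[], .nil _, fun _ h => absurd h List.not_mem_nil⟩

/-- No path to `γ` queries `q`. -/
def Unqueried (B : BranchingProgram V k S) (γ : S) (q : V) : Prop :=
  ∀ p, B.IsPath B.start p γ → q ∉ p.map Prod.fst

theorem Unqueried.reaches_update [DecidableEq V] {I : V → Fin k} {γ : S} {q : V}
    (hu : B.Unqueried γ q) (hr : B.Reaches I γ) (a : Fin k) :
    B.Reaches (Function.update I q a) γ := by
  obtain ⟨p, hp, hc⟩ := hr
  refine ⟨p, hp, fun e he => ?_⟩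
  rw [Function.update_of_ne, hc e he]
  rintro rfl
  exact hu p hp (List.mem_map_of_mem he)

/-- Any path to `γ` can be glued to the given continuation, even if no input follows the result;
this is where syntactic, not semantic, read-once matters. -/
theorem SyntacticReadOnce.unqueried (honce : B.SyntacticReadOnce) {γ t : S} {q : V} {a c : Fin k}
    {p : List (V × Fin k)} (hp : B.IsPath γ ((q, a) :: p) t) (ht : B.label t = Sum.inr c) :
    B.Unqueried γ q := by
  intro p₀ hp₀ hq
  have := honce _ t c (hp₀.append hp) ht
  rw [List.map_append, List.nodup_append'] at this
  exact this.2.2 hq (by simp)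

end paths

variable {h k : ℕ} {S : Type*} {B : BranchingProgram (TEPVar h k) k S}

/-- Each node value in `w` is a possible one at `γ`. -/
def Compatible (B : BranchingProgram (TEPVar h k) k S) (γ : S) (w : TreeNode h → Fin k) : Prop :=
  ∀ i, w i ∈ B.reachSet γ i

theorem Compatible.update [DecidableEq (TreeNode h)] {γ : S} {w : TreeNode h → Fin k}
    (hw : B.Compatible γ w) {i : TreeNode h} {c : Fin k} (hc : c ∈ B.reachSet γ i) :
    B.Compatible γ (Function.update w i c) := by
  intro j
  by_cases e : j = i
  · subst e
    rwa [Function.update_self]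
  · rw [Function.update_of_ne e]
    exact hw j

theorem Reaches.compatible {I : TEPInput h k} {γ : S} (hr : B.Reaches I γ) :
    B.Compatible γ (nodeValue I) :=
  fun _ => ⟨I, hr, rfl⟩

theorem NodeIndependent.reaches (hindep : B.NodeIndependent) {γ : S} {I : TEPInput h k}
    (hI : B.Compatible γ (nodeValue I)) : B.Reaches I γ :=
  (hindep γ I).1.mpr hI

theorem NodeIndependent.compatible_step (hindep : B.NodeIndependent) {γ δ : S}
    {q : TEPVar h k} {a : Fin k} (hq : B.label γ = Sum.inl q) (he : B.edge γ a δ)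
    {w : TreeNode h → Fin k} (hw : B.Compatible γ w)
    (hwa : ∀ i, q = thriftyVar w i → w i = a) : B.Compatible δ w := by
  classical
  have e := nodeValue_update_constInput hwa
  have hr : B.Reaches (Function.update (constInput w) q a) γ := hindep.reaches (by rwa [e])
  have := (hr.step hq he (Function.update_self ..)).compatible
  rwa [e] at this

theorem NodeIndependent.compatible_update [DecidableEq (TreeNode h)]
    (hindep : B.NodeIndependent) {γ : S}
    {w : TreeNode h → Fin k} {i : TreeNode h} (hu : B.Unqueried γ (thriftyVar w i))
    (hw : B.Compatible γ w) (a : Fin k) : B.Compatible γ (Function.update w i a) := by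
  classical
  have hr : B.Reaches (constInput w) γ := hindep.reaches (by rwa [nodeValue_constInput])
  have := (hu.reaches_update hr a).compatible
  rwa [nodeValue_update_constInput_thriftyVar] at this

/-- A value of node `j` can be lost in a step only if the step queries the variable that determines
`j`, and only if the children of `j` (if any) have just one possible value each. -/
theorem NodeIndependent.children_of_lost (hindep : B.NodeIndependent) {γ δ : S}
    {q : TEPVar h k} {a : Fin k} (hq : B.label γ = Sum.inl q) (he : B.edge γ a δ)
    (hu : B.Unqueried γ q) {v : TreeNode h → Fin k} (hv : B.Compatible γ v)
    {j : TreeNode h} {c : Fin k} (hc : c ∈ B.reachSet γ j) (hc' : c ∉ B.reachSet δ j)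
    (hj : j.IsInternal) :
    (∀ x ∈ B.reachSet γ (j.left hj), x = v (j.left hj)) ∧
      ∀ y ∈ B.reachSet γ (j.right hj), y = v (j.right hj) := by
  classical
  have hw := hv.update hc
  have hqj : q = thriftyVar v j := by
    -- If the answer `a` does not contradict `v` with `c` at `j`, this vector survives the step and
    -- keeps `c`.
    by_cases hwa : ∀ i, q = thriftyVar (Function.update v j c) i → Function.update v j c i = a
    · have := hindep.compatible_step hq he hw hwa j
      rw [Function.update_self] at this
      exact absurd this hc'
    · push Not at hwa
      obtain ⟨i, hqi, -⟩ := hwa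
      by_cases hij : i = j
      · subst hij
        rw [hqi, thriftyVar_update_self]
      -- If `q` determines another node `i`, giving `i` the value `a` lets the vector pass without
      -- touching `c` at `j`.
      · have h1 := hindep.compatible_update (hqi ▸ hu) hw a
        have h2 := hindep.compatible_step hq he h1 (by
          intro i' hi'
          have := thriftyVar_inj (hi'.symm.trans hqi)
          rw [this, Function.update_self])
        have := h2 j
        rw [Function.update_of_ne (Ne.symm hij), Function.update_self] at this
        exact absurd this hc'
  -- If changing `l` moved the variable of `j` away from `q`, the changed vector would not read `q`
  -- at all and would carry `c` to `δ`.
  have key : ∀ l : TreeNode h, l ≠ j → ∀ x ∈ B.reachSet γ l,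
      thriftyVar (Function.update (Function.update v j c) l x) j = thriftyVar v j := by
    intro l hl x hx
    by_contra hne
    have := hindep.compatible_step hq he (hw.update hx) (by
      intro i hi
      have hij : j = i := thriftyVar_inj (hqj.symm.trans hi)
      subst hij
      exact absurd (hi.symm.trans hqj) hne) j
    rw [Function.update_of_ne hl.symm, Function.update_self] at this
    exact hc' this
  constructor
  · intro x hx
    have := key _ (j.left_ne hj) x hx
    rw [thriftyVar_of_internal _ hj, thriftyVar_of_internal _ hj] at this
    have := (TEPVar.func.inj this).2.1
    rwa [Function.update_self] at this
  · intro x hx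
    have := key _ (j.right_ne hj) x hx
    rw [thriftyVar_of_internal _ hj, thriftyVar_of_internal _ hj] at this
    have := (TEPVar.func.inj this).2.2
    rwa [Function.update_self] at this

/-- Node `n` has no value but `v n` at the state `γ`. -/
def Pebbled (B : BranchingProgram (TEPVar h k) k S) (v : TreeNode h → Fin k) (γ : S) (n : ℕ) :
    Prop :=
  ∃ hn, ∀ c ∈ B.reachSet γ ⟨n, hn⟩, c = v ⟨n, hn⟩

theorem NodeIndependent.pebbled_children (hindep : B.NodeIndependent) {γ δ : S}
    {q : TEPVar h k} {a : Fin k} (hq : B.label γ = Sum.inl q) (he : B.edge γ a δ)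
    (hu : B.Unqueried γ q) {v : TreeNode h → Fin k} (hv : B.Compatible γ v)
    {i : ℕ} (hih : 2 * i + 1 < 2 ^ h) (hδ : B.Pebbled v δ i)
    (hγ : ¬ B.Pebbled v γ i) : B.Pebbled v γ (2 * i) ∧ B.Pebbled v γ (2 * i + 1) := by
  obtain ⟨hn, hδ⟩ := hδ
  have : ∃ c ∈ B.reachSet γ ⟨i, hn⟩, c ≠ v ⟨i, hn⟩ := by
    by_contra hcon
    push Not at hcon
    exact hγ ⟨hn, hcon⟩
  obtain ⟨c, hc, hne⟩ := this
  have hint : TreeNode.IsInternal (⟨i, hn⟩ : TreeNode h) := by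
    change i < 2 ^ (h - 1)
    cases h with
    | zero => simp at hih
    | succ m =>
      rw [pow_succ] at hih
      simp only [Nat.add_sub_cancel]
      omega
  have h2 := hindep.children_of_lost hq he hu hv hc (fun hc' => hne (hδ c hc')) hint
  exact ⟨⟨_, h2.1⟩, ⟨_, h2.2⟩⟩

/-- On every complete computation path there is a state with at least `h` pebbled nodes. -/
theorem exists_state_pebbled (hh : 0 < h) (hk : 2 ≤ k) (hsolves : B.Computes (treeEval hh))
    (hindep : B.NodeIndependent) (honce : B.SyntacticReadOnce) (I : TEPInput h k) :
    ∃ γ, B.Reaches I γ ∧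
      ∃ F : Finset ℕ, F.card = h ∧ ∀ n ∈ F, B.Pebbled (nodeValue I) γ n := by
  obtain ⟨t, c, ⟨p, hp, hI⟩, ht⟩ := (hsolves I).1
  have main : ∀ {γ u : S} {p : List (TEPVar h k × Fin k)}, B.IsPath γ p u →
      B.label u = Sum.inr c → Consistent I p → B.Reaches I γ →
      ¬ Blocked (B.Pebbled (nodeValue I) γ) h 1 →
      ∃ γ, B.Reaches I γ ∧
        ∃ F : Finset ℕ, F.card = h ∧ ∀ n ∈ F, B.Pebbled (nodeValue I) γ n := by
    intro γ u p hp
    induction hp with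
    | nil s =>
      intro hs _ hr hnb
      refine (hnb ?_).elim
      obtain ⟨m, rfl⟩ := Nat.exists_eq_add_of_lt hh
      -- Correctness pebbles the root at an output state.
      refine Or.inl ⟨(TreeNode.root hh).2, ?_⟩
      rintro x ⟨J, hJ, rfl⟩
      exact ((hsolves J).2 s c hJ hs).symm.trans ((hsolves I).2 s c hr hs)
    | @cons s δ u q a p hq he hp ih =>
      intro hu hc hr hnb
      have hIq : I q = a := hc (q, a) List.mem_cons_self
      have hrδ := hr.step hq he hIq
      by_cases hb : Blocked (B.Pebbled (nodeValue I) δ) h 1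
      · have hun := honce.unqueried (.cons hq he hp) hu
        obtain ⟨F, hF, hFb⟩ := exists_card_of_blocked (h := h)
          (fun _ _ hih hδ hγ =>
            hindep.pebbled_children hq he hun hr.compatible hih hδ hγ)
          le_rfl le_rfl hnb hb
        exact ⟨δ, hrδ, F, hF, fun n hn => (hFb n hn).2⟩
      · exact ih hu (fun e he => hc e (List.mem_cons_of_mem _ he)) hrδ hb
  refine main hp ht hI (reaches_start I) fun hb => ?_
  -- Every input reaches the start, so with two values available no node is pebbled there.
  obtain ⟨n, -, hn, hpeb⟩ := hb.exists_mem
  have : Nontrivial (Fin k) := Fin.nontrivial_iff_two_le.mpr hk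
  obtain ⟨x, hx⟩ := exists_ne (nodeValue I ⟨n, hn⟩)
  refine hx (hpeb x ⟨constInput fun _ => x, reaches_start _, ?_⟩)
  rw [nodeValue_constInput]

/-- A bound on the number of vectors of node values possible at a state with given pebbled nodes. -/
theorem card_compatible_le {γ : S} [DecidablePred fun w => B.Compatible γ w]
    {v : TreeNode h → Fin k} {F : Finset ℕ} (hF : ∀ n ∈ F, B.Pebbled v γ n) :
    (Finset.univ.filter fun w => B.Compatible γ w).card ≤
      k ^ (Fintype.card (TreeNode h) - F.card) := by
  classical
  let G : Finset (TreeNode h) := Finset.univ.filter fun i => i.1 ∈ F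
  have hG : G.card = F.card := by
    refine Finset.card_bij (fun i _ => i.1) (fun i hi => (Finset.mem_filter.mp hi).2)
      (fun i _ j _ e => Subtype.ext e) fun n hn => ?_
    obtain ⟨hn', -⟩ := hF n hn
    exact ⟨⟨n, hn'⟩, Finset.mem_filter.mpr ⟨Finset.mem_univ _, hn⟩, rfl⟩
  have hinj : (Finset.univ.filter fun w => B.Compatible γ w).card ≤
      (Finset.univ : Finset ({i // i ∉ G} → Fin k)).card := by
    refine Finset.card_le_card_of_injOn (fun w i => w i.1) (fun _ _ => Finset.mem_univ _) ?_
    intro w hw w' hw' e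
    have hw := (Finset.mem_filter.mp hw).2
    have hw' := (Finset.mem_filter.mp hw').2
    funext i
    by_cases hi : i ∈ G
    · obtain ⟨_, hp⟩ := hF i.1 (Finset.mem_filter.mp hi).2
      rw [hp _ (hw i), hp _ (hw' i)]
    · exact congrFun e ⟨i, hi⟩
  refine hinj.trans_eq ?_
  rw [Finset.card_univ, Fintype.card_fun, Fintype.card_fin, Fintype.card_subtype_compl,
    Fintype.card_coe, Fintype.card_coe, hG]

/-- The number of states is at least `k ^ h`. -/
theorem pow_le_card [Fintype S] (hh : 0 < h) (hk : 2 ≤ k) (hsolves : B.Computes (treeEval hh))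
    (hindep : B.NodeIndependent) (honce : B.SyntacticReadOnce) : k ^ h ≤ Fintype.card S := by
  classical
  choose st hst F hF hFp using fun w : TreeNode h → Fin k =>
    exists_state_pebbled hh hk hsolves hindep honce (constInput w)
  have hcompat : ∀ w, B.Compatible (st w) w := fun w => by
    have := (hst w).compatible
    rwa [nodeValue_constInput] at this
  have hcard : h ≤ Fintype.card (TreeNode h) := by
    rw [Fintype.card_coe, Nat.card_Ico]
    have := Nat.lt_two_pow_self (n := h)
    omega
  have hmul : (Finset.univ : Finset (TreeNode h → Fin k)).card ≤
      k ^ (Fintype.card (TreeNode h) - h) * (Finset.univ : Finset S).card := by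
    refine Finset.card_le_mul_card_image_of_maps_to (f := st) (fun _ _ => Finset.mem_univ _) _ ?_
    intro γ _
    rcases (Finset.univ.filter fun w => st w = γ).eq_empty_or_nonempty with h0 | ⟨w, hw⟩
    · rw [h0]
      exact Nat.zero_le _
    · obtain rfl := (Finset.mem_filter.mp hw).2
      refine (Finset.card_le_card ?_).trans ((card_compatible_le (hFp w)).trans_eq (by rw [hF]))
      intro w' hw'
      refine Finset.mem_filter.mpr ⟨Finset.mem_univ _, ?_⟩
      rw [← (Finset.mem_filter.mp hw').2]
      exact hcompat w'
  rw [Finset.card_univ, Finset.card_univ, Fintype.card_fun, Fintype.card_fin] at hmul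
  refine Nat.le_of_mul_le_mul_left ?_ (pow_pos (by omega : 0 < k) (Fintype.card (TreeNode h) - h))
  rwa [← pow_add, Nat.sub_add_cancel hcard]

end BranchingProgram

theorem theorem3 {h k : ℕ} (hh : 2 ≤ h) (hk : 1 ≤ k) {S : Type*} [Fintype S]
    (B : BranchingProgram (TEPVar h k) k S)
    (hsolves : B.Computes (treeEval (lt_of_lt_of_le Nat.zero_lt_two hh)))
    (hindep : B.NodeIndependent) (honce : B.SyntacticReadOnce) :
    (k : ℝ) ^ ((h : ℝ) / 2 + 1) ≤ (Fintype.card S : ℝ) := by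
  rcases hk.eq_or_lt with rfl | hk2
  · rw [Nat.cast_one, Real.one_rpow]
    exact_mod_cast Fintype.card_pos_iff.mpr ⟨B.start⟩
  · have hh' : (2 : ℝ) ≤ h := by exact_mod_cast hh
    calc (k : ℝ) ^ ((h : ℝ) / 2 + 1) ≤ (k : ℝ) ^ (h : ℝ) :=
          Real.rpow_le_rpow_of_exponent_le (by exact_mod_cast hk) (by linarith)
      _ = ((k ^ h : ℕ) : ℝ) := by rw [Real.rpow_natCast, Nat.cast_pow]
      _ ≤ (Fintype.card S : ℝ) := by
          exact_mod_cast BranchingProgram.pow_le_card _ hk2 hsolves hindep honce
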